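/- Let $G$ be a locally compact (Hausdorff) group with left Haar measure $\mu$. For $1\le p<\infty$, a weight is a measurable function $\omega:G\to(0,\infty)$ with $\omega\in L^p(K)$ for every compact $K\subset G$, and $L^p(G,\omega)$ is the space of complex-valued functions $f$ with $\|f\|_{p,\omega}=\big(\int_G|f\omega|^p\,d\mu\big)^{1/p}<\infty$. Let $(T_sf)(t)=f(s^{-1}t)$. For $S\subset G$, the weight $\omega$ is $S$-admissible if $T_s$ is a bounded operator on $L^p(G,\omega)$ for every $s\in S$, and $f\in L^p(G,\omega)$ is $S$-dense if $\{T_sf:s\in S\}$ is dense in $L^p(G,\omega)$. The following are equivalent: (1) $G$ is non-compact and second countable; (2) $G$ is non-compact, and for every subset $S\subset G$ with non-compact closure there is an $S$-admissible weight $\omega$ such that $L^p(G,\omega)$ contains $S$-dense vectors, for all (equivalently, for some) $p\in[1,\infty)$; (3) there is a weight $\omega$ such that all left translations $f\mapsto f(s^{-1}\,\cdot\,)$ and all right translations $f\mapsto f(\,\cdot\,s)$, $s\in G$, are bounded on $L^p(G,\omega)$ and $L^p(G,\omega)$ contains $G$-dense functions, for all (equivalently, for some) $p\in[1,\infty)$.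 Here "for all $p$" means that one and the same $\omega$ has the stated properties for every $p\in[1,\infty)$, and "for some $p$" means that $\omega$ has them for at least one $p\in[1,\infty)$ (which in (2) may depend on $S$). -/

import Mathlib

open MeasureTheory
open scoped ENNReal NNReal

namespace WeightedTranslates

variable {G : Type*} [Group G] [TopologicalSpace G] [MeasurableSpace G]

/-- A weight (for the exponent `p`): a measurable strictly positive function on `G` which is
locally `p`-summable, that is, belongs to `L^p(K)` for every compact `K`. -/
structure IsWeight (μ : Measure G) (p : ℝ≥0∞) (ω : G → ℝ) : Prop where
  measurable : Measurable ω
  pos : ∀ t, 0 < ω t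
  locally_summable : ∀ K : Set G, IsCompact K → MemLp ω p (μ.restrict K)

/-- `f ∈ L^p(G, ω)`, that is, `f ω ∈ L^p(G)`, for a complex-valued `f`. -/
def MemWeighted (μ : Measure G) (p : ℝ≥0∞) (ω : G → ℝ) (f : G → ℂ) : Prop :=
  MemLp (fun t => f t * (ω t : ℂ)) p μ

/-- The norm of `L^p(G, ω)`: `‖f‖_{p,ω} = (∫ |f ω|^p dμ)^{1/p}`. -/
noncomputable def weightedNorm (μ : Measure G) (p : ℝ≥0∞) (ω : G → ℝ) (f : G → ℂ) : ℝ≥0∞ :=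
  eLpNorm (fun t => f t * (ω t : ℂ)) p μ

/-- The left translation `(T_s f)(t) = f(s⁻¹ t)`. -/
def leftTranslate (s : G) (f : G → ℂ) : G → ℂ := fun t => f (s⁻¹ * t)

/-- The right translation `t ↦ f(t s)`. -/
def rightTranslate (s : G) (f : G → ℂ) : G → ℂ := fun t => f (t * s)

/-- `T` maps `L^p(G, ω)` into itself with finite norm (used for translations, which are linear and
respect almost everywhere equality for a left Haar measure). -/
def BoundedOn (μ : Measure G) (p : ℝ≥0∞) (ω : G → ℝ) (T : (G → ℂ) → (G → ℂ)) : Prop :=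
  ∃ C : ℝ≥0, ∀ f : G → ℂ, MemWeighted μ p ω f →
    MemWeighted μ p ω (T f) ∧ weightedNorm μ p ω (T f) ≤ C * weightedNorm μ p ω f

/-- `ω` is `S`-admissible: `‖T_s‖ < ∞` on `L^p(G, ω)` for all `s ∈ S`. -/
def IsAdmissible (μ : Measure G) (p : ℝ≥0∞) (ω : G → ℝ) (S : Set G) : Prop :=
  ∀ s ∈ S, BoundedOn μ p ω (leftTranslate s)

/-- `f` is an `S`-dense vector of `L^p(G, ω)`: the orbit `{T_s f : s ∈ S}` is dense in
`L^p(G, ω)`. -/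
def IsDenseVector (μ : Measure G) (p : ℝ≥0∞) (ω : G → ℝ) (S : Set G) (f : G → ℂ) : Prop :=
  MemWeighted μ p ω f ∧
    ∀ g : G → ℂ, MemWeighted μ p ω g → ∀ ε : ℝ≥0∞, 0 < ε →
      ∃ s ∈ S, weightedNorm μ p ω (leftTranslate s f - g) < ε

/-- `ω` is an `S`-admissible weight and `L^p(G, ω)` contains `S`-dense vectors. -/
def HasDenseVectors (μ : Measure G) (p : ℝ≥0∞) (ω : G → ℝ) (S : Set G) : Prop :=
  IsWeight μ p ω ∧ IsAdmissible μ p ω S ∧ ∃ f : G → ℂ, IsDenseVector μ p ω S f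

/-- `ω` is a weight, all left and right translations are bounded on `L^p(G, ω)`, and `L^p(G, ω)`
contains `G`-dense functions. -/
def HasDenseVectorsTwoSided (μ : Measure G) (p : ℝ≥0∞) (ω : G → ℝ) : Prop :=
  IsWeight μ p ω ∧ (∀ s : G, BoundedOn μ p ω (leftTranslate s)) ∧
    (∀ s : G, BoundedOn μ p ω (rightTranslate s)) ∧
    ∃ f : G → ℂ, IsDenseVector μ p ω Set.univ f

end WeightedTranslates

namespace WeightedTranslates

open Filter Topology Set
open scoped Pointwise

/-! ### Approximation in measure on compact sets, and non-compactness. -/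

section CloseInMeasure

/-! Necessity: a weight is bounded below on a compact set `K` up to small measure, so weighted
density yields translates of `f` close in measure on `K` to the indicator of any compact `A`. If `G`
were compact, translation invariance would make `f` itself close to both 0 and 1. Next, `f` lives
a.e. on a σ-compact subgroup containing a neighbourhood of 1; a proper subgroup of this kind could
not serve two of its cosets at once, so `G` is σ-compact. Finally, translates of `P = {|f - 1| <
1/2}` approximate every compact set, so the countably many conditions "`x` moves `s • P` by less
than `1/n` for all `s` in the `m`-th compact set" detect how far `x` is from 1. Hence `G` is first
countable, and with σ-compactness second countable.

Sufficiency: σ-compactness gives a proper length `ℓ`, and `2 ^ (-ℓ)` is a weight, independent of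
`p`, with all translations bounded. For approximants `g m` vanishing off balls of `ℓ` and a sparse
sequence `s m` in `S` going to infinity, `f = ∑ T_{(s m)⁻¹} (g m)` is dense: `T_{s n} f - g n` is a
sum of pieces pushed far out, of norm at most `2 ^ (1 - n)`
(`IsProperLength.exists_isDenseVector_of_seq`). -/

theorem exists_isCompact_mul_exhaustion {G : Type*} [Group G] [TopologicalSpace G]
    [IsTopologicalGroup G] (C : ℕ → Set G) (hC : ∀ n, IsCompact (C n)) :
    ∃ E : ℕ → Set G, (∀ n, IsCompact (E n)) ∧ (∀ n, 1 ∈ E n) ∧ (∀ n, (E n)⁻¹ = E n) ∧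
      (∀ n, E n * E n ⊆ E (n + 1)) ∧ ∀ n, C n ⊆ E n := by
  let E : ℕ → Set G := fun n => Nat.rec ({1} ∪ (C 0 ∪ (C 0)⁻¹))
    (fun n A => A * A ∪ (C (n + 1) ∪ (C (n + 1))⁻¹)) n
  have hE : ∀ n, E (n + 1) = E n * E n ∪ (C (n + 1) ∪ (C (n + 1))⁻¹) := fun n => rfl
  have h0 : E 0 = {1} ∪ (C 0 ∪ (C 0)⁻¹) := rfl
  refine ⟨E, fun n => ?_, fun n => ?_, fun n => ?_, fun n => ?_, fun n => ?_⟩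
  · induction n with
    | zero => exact isCompact_singleton.union ((hC 0).union (hC 0).inv)
    | succ n ih => rw [hE]; exact (ih.mul ih).union ((hC _).union (hC _).inv)
  · induction n with
    | zero => simp [h0]
    | succ n ih => rw [hE]; exact Or.inl ⟨1, ih, 1, ih, one_mul 1⟩
  · induction n with
    | zero => simp [h0, Set.union_inv, Set.union_comm (C 0)]
    | succ n ih =>
      rw [hE, Set.union_inv, Set.union_inv, mul_inv_rev, ih, inv_inv, Set.union_comm (C (n + 1))]
  · rw [hE]; exact subset_union_left
  · cases n with
    | zero => rw [h0]; exact subset_union_left.trans subset_union_right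
    | succ n => rw [hE]; exact subset_union_left.trans subset_union_right

variable {G : Type*} [MeasurableSpace G] {μ : Measure G} {p : ℝ≥0∞} {ω : G → ℝ}

theorem MemWeighted.aestronglyMeasurable {f : G → ℂ} (hω : Measurable ω) (hpos : ∀ t, 0 < ω t)
    (hf : MemWeighted μ p ω f) : AEStronglyMeasurable f μ := by
  have h1 : AEStronglyMeasurable (fun t => ((ω t : ℂ))⁻¹) μ :=
    (Complex.measurable_ofReal.comp hω).inv.aestronglyMeasurable
  have h2 : f = fun t => f t * (ω t : ℂ) * ((ω t : ℂ))⁻¹ := by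
    ext t
    have : (ω t : ℂ) ≠ 0 := by exact_mod_cast (hpos t).ne'
    field_simp
  rw [h2]
  exact hf.1.mul h1

theorem exists_measure_inter_lt_inv_lt {K : Set G} (hK : MeasurableSet K) (hKμ : μ K ≠ ∞)
    (hω : Measurable ω) (hpos : ∀ t, 0 < ω t) {η : ℝ≥0∞} (hη : η ≠ 0) :
    ∃ n : ℕ, μ (K ∩ {t | ω t < 1 / ((n : ℝ) + 1)}) < η := by
  have h := tendsto_measure_iInter_atTop (μ := μ)
    (s := fun n : ℕ => K ∩ {t | ω t < 1 / ((n : ℝ) + 1)})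
    (fun n => (hK.inter (measurableSet_lt hω measurable_const)).nullMeasurableSet)
    (fun m n hmn t ht => ⟨ht.1, by
      have h2 : ω t < 1 / ((n : ℝ) + 1) := ht.2
      exact h2.trans_le (Nat.one_div_le_one_div hmn)⟩)
    ⟨0, measure_ne_top_of_subset inter_subset_left hKμ⟩
  have he : ⋂ n : ℕ, K ∩ {t | ω t < 1 / ((n : ℝ) + 1)} = ∅ := by
    refine eq_empty_of_forall_notMem fun t ht => ?_
    obtain ⟨n, hn⟩ := exists_nat_one_div_lt (hpos t)
    exact lt_asymm hn (mem_iInter.1 ht n).2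
  rw [he, measure_empty] at h
  exact (h.eventually (gt_mem_nhds (pos_iff_ne_zero.2 hη))).exists

/-- Off a part of `K` of measure below `η / 2` the weight is at least `1 / (n + 1)`; Chebyshev's
inequality at level `δ / (n + 1)` controls the rest. -/
theorem exists_forall_eLpNorm_lt_measure_lt {K : Set G} (hK : MeasurableSet K) (hKμ : μ K ≠ ∞)
    (hω : Measurable ω) (hpos : ∀ t, 0 < ω t) (hp0 : p ≠ 0) (hp : p ≠ ∞) {δ : ℝ} (hδ : 0 < δ)
    {η : ℝ≥0∞} (hη : η ≠ 0) (hη' : η ≠ ∞) :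
    ∃ ε : ℝ≥0∞, 0 < ε ∧ ∀ h : G → ℂ, AEStronglyMeasurable h μ → weightedNorm μ p ω h < ε →
      μ (K ∩ {t | δ ≤ ‖h t‖}) < η := by
  have hη2 : η / 2 ≠ 0 := (ENNReal.half_pos hη).ne'
  obtain ⟨n, hn⟩ := exists_measure_inter_lt_inv_lt hK hKμ hω hpos hη2
  have ha : 0 < δ * (1 / ((n : ℝ) + 1)) := by positivity
  set a : ℝ≥0∞ := ENNReal.ofReal (δ * (1 / ((n : ℝ) + 1))) with ha'
  have ha0 : a ≠ 0 := (ENNReal.ofReal_pos.2 ha).ne'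
  have hp' : 0 < p.toReal := ENNReal.toReal_pos hp0 hp
  refine ⟨a * (η / 2) ^ (p.toReal)⁻¹, ENNReal.mul_pos ha0 (ENNReal.rpow_pos_of_nonneg
    (pos_iff_ne_zero.2 hη2) (by positivity)).ne', fun h hm hlt => ?_⟩
  have hm' : AEStronglyMeasurable (fun t => h t * (ω t : ℂ)) μ :=
    hm.mul (Complex.measurable_ofReal.comp hω).aestronglyMeasurable
  have h1 := meas_ge_le_mul_pow_eLpNorm_enorm μ hp0 hp hm' ha0 (fun h => by simp [ha'] at h)
  have h2 : μ {x | a ≤ ‖h x * (ω x : ℂ)‖ₑ} ≤ η / 2 := by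
    refine h1.trans ?_
    rw [← ENNReal.mul_rpow_of_nonneg _ _ hp'.le]
    calc _ ≤ (a⁻¹ * (a * (η / 2) ^ (p.toReal)⁻¹)) ^ p.toReal := by
          gcongr; exact hlt.le
      _ = η / 2 := by
          rw [← mul_assoc, ENNReal.inv_mul_cancel ha0 ENNReal.ofReal_ne_top, one_mul,
            ENNReal.rpow_inv_rpow hp'.ne']
  calc μ (K ∩ {t | δ ≤ ‖h t‖})
      ≤ μ ((K ∩ {t | ω t < 1 / ((n : ℝ) + 1)}) ∪ {x | a ≤ ‖h x * (ω x : ℂ)‖ₑ}) := by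
        refine measure_mono fun t ht => ?_
        by_cases hc : ω t < 1 / ((n : ℝ) + 1)
        · exact Or.inl ⟨ht.1, hc⟩
        · right
          rw [mem_ofPred_eq, ← ofReal_norm, ha', norm_mul, Complex.norm_real,
            Real.norm_of_nonneg (hpos t).le]
          exact ENNReal.ofReal_le_ofReal (mul_le_mul ht.2 (not_lt.1 hc) (by positivity)
            (norm_nonneg _))
    _ ≤ μ (K ∩ {t | ω t < 1 / ((n : ℝ) + 1)}) + μ {x | a ≤ ‖h x * (ω x : ℂ)‖ₑ} :=
        measure_union_le _ _
    _ < η / 2 + η / 2 := ENNReal.add_lt_add_of_lt_of_le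
        (measure_ne_top_of_subset subset_rfl (h2.trans_lt
          (ENNReal.div_lt_top hη' two_ne_zero)).ne) hn h2
    _ = η := ENNReal.add_halves η

variable [Group G] [TopologicalSpace G] [IsTopologicalGroup G] [BorelSpace G]
  [μ.IsHaarMeasure]

theorem aestronglyMeasurable_leftTranslate {f : G → ℂ} (hf : AEStronglyMeasurable f μ) (s : G) :
    AEStronglyMeasurable (leftTranslate s f) μ :=
  hf.comp_measurePreserving (measurePreserving_mul_left μ s⁻¹)

variable [T2Space G]

theorem IsDenseVector.exists_translate_close_in_measure {f : G → ℂ} (hw : IsWeight μ p ω)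
    (hp0 : p ≠ 0) (hp : p ≠ ∞) (hf : IsDenseVector μ p ω univ f) {A K : Set G}
    (hA : IsCompact A) (hK : IsCompact K) {δ : ℝ} (hδ : 0 < δ) {η : ℝ≥0∞} (hη : η ≠ 0)
    (hη' : η ≠ ∞) :
    ∃ s : G, μ (K ∩ {t | δ ≤ ‖f (s⁻¹ * t) - A.indicator 1 t‖}) < η := by
  obtain ⟨ε, hε, h⟩ := exists_forall_eLpNorm_lt_measure_lt hK.measurableSet
    (hK.measure_lt_top (μ := μ)).ne hw.measurable hw.pos hp0 hp hδ hη hη'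
  have hg : MemWeighted μ p ω (A.indicator 1) := by
    have h1 := (hw.locally_summable A hA).ofReal (K := ℂ)
    rw [← memLp_indicator_iff_restrict hA.measurableSet] at h1
    unfold MemWeighted
    convert h1 using 2 with t
    by_cases ht : t ∈ A <;> simp [ht]
  obtain ⟨s, -, hs⟩ := hf.2 _ hg ε hε
  exact ⟨s, h _ ((aestronglyMeasurable_leftTranslate
    (hf.1.aestronglyMeasurable hw.measurable hw.pos) s).sub
    (hg.aestronglyMeasurable hw.measurable hw.pos)) hs⟩

theorem IsDenseVector.noncompactSpace {f : G → ℂ} (hw : IsWeight μ p ω)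
    (hp0 : p ≠ 0) (hp : p ≠ ∞) (hf : IsDenseVector μ p ω univ f) : NoncompactSpace G := by
  rw [← not_compactSpace_iff]
  intro hc
  have hM : μ univ ≠ 0 := (isOpen_univ.measure_pos μ univ_nonempty).ne'
  have hM' : μ univ ≠ ∞ := isCompact_univ.measure_lt_top.ne
  have hη : μ univ / 2 ≠ 0 := (ENNReal.half_pos hM).ne'
  have hη' : μ univ / 2 ≠ ∞ := (ENNReal.div_lt_top hM' two_ne_zero).ne
  have key : ∀ A : Set G, IsCompact A → ∀ c : ℂ, A.indicator 1 = (fun _ => c) →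
      μ {t | (1 / 2 : ℝ) ≤ ‖f t - c‖} < μ univ / 2 := by
    intro A hA c hc
    obtain ⟨s, hs⟩ := hf.exists_translate_close_in_measure hw hp0 hp hA isCompact_univ
      (δ := 1 / 2) (by norm_num) hη hη'
    rw [hc, univ_inter] at hs
    rwa [← measure_preimage_mul μ s⁻¹]
  have h0 := key ∅ isCompact_empty 0 (by ext; simp)
  have h1 := key univ isCompact_univ 1 (by ext; simp)
  have : μ univ < μ univ := calc
    μ univ ≤ μ ({t | (1 / 2 : ℝ) ≤ ‖f t - 0‖} ∪ {t | (1 / 2 : ℝ) ≤ ‖f t - 1‖}) := by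
        refine measure_mono fun t _ => ?_
        by_contra hcon
        simp only [mem_union, mem_ofPred_eq, not_or, not_le, sub_zero] at hcon
        have h2 := norm_sub_le (f t) (f t - 1)
        rw [sub_sub_cancel, norm_one] at h2
        linarith [hcon.1, hcon.2]
    _ ≤ _ := measure_union_le _ _
    _ < μ univ / 2 + μ univ / 2 := ENNReal.add_lt_add h0 h1
    _ = μ univ := ENNReal.add_halves _
  exact lt_irrefl _ this

end CloseInMeasure

/-! ### From a dense vector to second countability. -/

section SecondCountable

variable {G : Type*} [MeasurableSpace G] {μ : Measure G} {p : ℝ≥0∞} {ω : G → ℝ}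
variable [TopologicalSpace G] [BorelSpace G]

/-- The sets `|f ω| ≥ 1 / (n + 1)` have finite measure, so inner regularity exhausts each by compact
sets up to a null set. -/
theorem MemWeighted.exists_compact_seq [T2Space G] [μ.Regular] {f : G → ℂ} (hw : IsWeight μ p ω) (hp0 : p ≠ 0)
    (hp : p ≠ ∞) (hf : MemWeighted μ p ω f) (hfm : Measurable f) :
    ∃ C : ℕ → Set G, (∀ n, IsCompact (C n)) ∧ μ ({t | f t ≠ 0} \ ⋃ n, C n) = 0 := by
  let A : ℕ → Set G := fun n => {t | ENNReal.ofReal (1 / ((n : ℝ) + 1)) ≤ ‖f t * (ω t : ℂ)‖ₑ}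
  have hm : Measurable fun t => f t * (ω t : ℂ) :=
    hfm.mul (Complex.measurable_ofReal.comp hw.measurable)
  have hA : ∀ n, MeasurableSet (A n) := fun n => measurableSet_le measurable_const hm.enorm
  have hAμ : ∀ n, μ (A n) ≠ ∞ := fun n => by
    refine ((meas_ge_le_mul_pow_eLpNorm_enorm μ hp0 hp hf.1
      (ENNReal.ofReal_pos.2 (Nat.one_div_pos_of_nat (n := n))).ne' (by simp)).trans_lt ?_).ne
    refine ENNReal.mul_lt_top (ENNReal.rpow_lt_top_of_nonneg ENNReal.toReal_nonneg
      (ENNReal.inv_ne_top.2 (ENNReal.ofReal_pos.2 (Nat.one_div_pos_of_nat (n := n))).ne'))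
      (ENNReal.rpow_lt_top_of_nonneg ENNReal.toReal_nonneg hf.2.ne)
  have hC : ∀ q : ℕ × ℕ, ∃ K ⊆ A q.1, IsCompact K ∧ μ (A q.1 \ K) < ((q.2 : ℝ≥0∞))⁻¹ :=
    fun q => (hA q.1).exists_isCompact_sdiff_lt (hAμ q.1) (by simp)
  choose K hKA hK hKμ using hC
  refine ⟨fun n => K n.unpair, fun n => hK _, ?_⟩
  have hsub : {t | f t ≠ 0} \ (⋃ n : ℕ, K n.unpair) ⊆ ⋃ n, A n \ ⋃ n : ℕ, K n.unpair := by
    rintro t ⟨ht, ht'⟩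
    have hpos : 0 < ‖f t * (ω t : ℂ)‖ := by
      have : (ω t : ℂ) ≠ 0 := by exact_mod_cast (hw.pos t).ne'
      exact norm_pos_iff.2 (mul_ne_zero ht this)
    obtain ⟨n, hn⟩ := exists_nat_one_div_lt hpos
    refine mem_iUnion.2 ⟨n, ?_, ht'⟩
    change ENNReal.ofReal _ ≤ ‖f t * (ω t : ℂ)‖ₑ
    rw [← ofReal_norm]
    exact ENNReal.ofReal_le_ofReal hn.le
  refine measure_mono_null hsub (measure_iUnion_null fun n => ?_)
  refine nonpos_iff_eq_zero.1 (ge_of_tendsto' ENNReal.tendsto_inv_nat_nhds_zero fun j => ?_)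
  refine (measure_mono ?_).trans (hKμ (n, j)).le
  refine sdiff_subset_sdiff_right ?_
  refine Subset.trans ?_ (subset_iUnion _ (Nat.pair n j))
  simp

variable [Group G] [IsTopologicalGroup G]
  [μ.IsHaarMeasure]

theorem IsDenseVector.exists_measurable {S : Set G} {f : G → ℂ} (hw : IsWeight μ p ω)
    (hf : IsDenseVector μ p ω S f) : ∃ f₀ : G → ℂ, Measurable f₀ ∧ IsDenseVector μ p ω S f₀ := by
  have hm := hf.1.aestronglyMeasurable hw.measurable hw.pos
  have he : f =ᵐ[μ] hm.mk f := hm.ae_eq_mk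
  refine ⟨hm.mk f, hm.stronglyMeasurable_mk.measurable, ?_, fun g hg ε hε => ?_⟩
  · refine (memLp_congr_ae ?_).1 hf.1
    filter_upwards [he] with t ht
    rw [ht]
  · obtain ⟨s, hs, h⟩ := hf.2 g hg ε hε
    refine ⟨s, hs, ?_⟩
    unfold weightedNorm at h ⊢
    rwa [eLpNorm_congr_ae]
    filter_upwards [(measurePreserving_mul_left μ s⁻¹).quasiMeasurePreserving.ae_eq_comp he]
      with t ht
    simp only [Function.comp_apply] at ht
    simp [leftTranslate, ht]

variable [T2Space G] [LocallyCompactSpace G] [μ.Regular]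

theorem IsDenseVector.sigmaCompactSpace {f : G → ℂ} (hw : IsWeight μ p ω) (hp0 : p ≠ 0)
    (hp : p ≠ ∞) (hf : IsDenseVector μ p ω univ f) (hfm : Measurable f) :
    SigmaCompactSpace G := by
  obtain ⟨C, hC, hCf⟩ := hf.1.exists_compact_seq hw hp0 hp hfm
  obtain ⟨V, hV, hV1⟩ := exists_compact_mem_nhds (1 : G)
  obtain ⟨E, hE, hE1, hEinv, hEmul, hCE⟩ :=
    exists_isCompact_mul_exhaustion (fun n => V ∪ C n) fun n => hV.union (hC n)
  have hmono : Monotone E := monotone_nat_of_le_succ fun n x hx =>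
    hEmul n ⟨x, hx, 1, hE1 n, mul_one x⟩
  let H : Subgroup G :=
    { carrier := ⋃ n, E n
      one_mem' := mem_iUnion.2 ⟨0, hE1 0⟩
      mul_mem' := by
        intro a b ha hb
        obtain ⟨m, hm⟩ := mem_iUnion.1 ha
        obtain ⟨n, hn⟩ := mem_iUnion.1 hb
        exact mem_iUnion.2 ⟨max m n + 1, hEmul _ ⟨a, hmono (le_max_left _ _) hm, b,
          hmono (le_max_right _ _) hn, rfl⟩⟩
      inv_mem' := by
        intro a ha
        obtain ⟨m, hm⟩ := mem_iUnion.1 ha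
        exact mem_iUnion.2 ⟨m, by rwa [← hEinv, Set.inv_mem_inv]⟩ }
  have hVH : ∀ v ∈ V, v ∈ H := fun v hv => mem_iUnion.2 ⟨0, hCE 0 (Or.inl hv)⟩
  have hN : μ {t | f t ≠ 0 ∧ t ∉ H} = 0 := by
    refine measure_mono_null ?_ hCf
    rintro t ⟨ht, htH⟩
    refine ⟨ht, fun hc => htH ?_⟩
    obtain ⟨n, hn⟩ := mem_iUnion.1 hc
    exact mem_iUnion.2 ⟨n, hCE n (Or.inr hn)⟩
  suffices h : ∀ x, x ∈ H from isSigmaCompact_univ_iff.1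
    ⟨E, hE, eq_univ_of_forall h⟩
  intro x
  by_contra hx
  have hK : IsCompact (V ∪ x • V) := hV.union (hV.smul x)
  obtain ⟨s, hs⟩ := hf.exists_translate_close_in_measure hw hp0 hp hK hK (δ := 1 / 2)
    (by norm_num) (Measure.measure_pos_of_mem_nhds μ hV1).ne' hV.measure_lt_top.ne
  -- `s⁻¹ V` and `s⁻¹ x V` lie in different left cosets of `H`, so one of them misses `H`; there `f`
  -- vanishes a.e. instead of being close to 1.
  obtain ⟨y, hyK, hy⟩ : ∃ y : G, y • V ⊆ V ∪ x • V ∧ ∀ v ∈ V, s⁻¹ * (y * v) ∉ H := by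
    by_cases hsH : s ∈ H
    · refine ⟨x, subset_union_right, fun v hv hc => hx ?_⟩
      rwa [H.mul_mem_cancel_left (H.inv_mem hsH), H.mul_mem_cancel_right (hVH v hv)] at hc
    · refine ⟨1, by simp, fun v hv hc => hsH ?_⟩
      rwa [one_mul, H.mul_mem_cancel_right (hVH v hv), H.inv_mem_iff] at hc
  refine lt_irrefl (μ V) ?_
  calc μ V = μ (y • V) := (measure_smul μ y V).symm
    _ ≤ μ (((V ∪ x • V) ∩ {t | 1 / 2 ≤ ‖f (s⁻¹ * t) - (V ∪ x • V).indicator 1 t‖}) ∪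
          (fun t => s⁻¹ * t) ⁻¹' {t | f t ≠ 0 ∧ t ∉ H}) := by
        refine measure_mono fun t ht => ?_
        obtain ⟨v, hv, rfl⟩ := ht
        by_cases hft : f (s⁻¹ * (y • v)) = 0
        · refine Or.inl ⟨hyK ⟨v, hv, rfl⟩, ?_⟩
          rw [mem_ofPred_eq]
          simp only
          rw [hft, indicator_of_mem (hyK ⟨v, hv, rfl⟩)]
          norm_num
        · exact Or.inr ⟨hft, hy v hv⟩
    _ ≤ _ := measure_union_le _ _
    _ = μ ((V ∪ x • V) ∩ {t | 1 / 2 ≤ ‖f (s⁻¹ * t) - (V ∪ x • V).indicator 1 t‖}) := by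
        rw [measure_preimage_mul, hN, add_zero]
    _ < μ V := hs

theorem tendsto_measure_smul_sdiff {Q : Set G} (hQ : MeasurableSet Q) (hQμ : μ Q ≠ ∞) :
    Tendsto (fun g : G => μ (g • Q \ Q)) (𝓝 1) (𝓝 0) := by
  rw [ENNReal.tendsto_nhds_zero]
  intro ε hε
  obtain ⟨F, hFQ, hF, hFμ⟩ := hQ.exists_isCompact_sdiff_lt hQμ (ENNReal.half_pos hε.ne').ne'
  have h := ENNReal.tendsto_nhds_zero.1
    (tendsto_measure_smul_sdiff_isCompact_isClosed (μ := μ) hF hF.isClosed) (ε / 2)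
    (ENNReal.half_pos hε.ne')
  filter_upwards [h] with g hg
  calc μ (g • Q \ Q) ≤ μ ((g • F \ F) ∪ g • (Q \ F)) := by
        refine measure_mono ?_
        rintro t ⟨⟨q, hq, rfl⟩, ht⟩
        by_cases hqF : q ∈ F
        · exact Or.inl ⟨⟨q, hqF, rfl⟩, fun hc => ht (hFQ hc)⟩
        · exact Or.inr ⟨q, ⟨hq, hqF⟩, rfl⟩
    _ ≤ _ := measure_union_le _ _
    _ ≤ ε / 2 + ε / 2 := by
        rw [measure_smul]
        exact add_le_add hg hFμ.le
    _ = ε := ENNReal.add_halves ε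

/-- `P` may have infinite measure. For `s * s₀⁻¹ ∈ Z`, only the part of `s₀ • P` in the compact set
`Z⁻¹ * V` can be moved into `V`, so the finite-measure case applies to that part. -/
theorem tendsto_measure_smul_sdiff_inter {P V : Set G} (hP : MeasurableSet P) (hV : IsCompact V)
    (s₀ : G) :
    Tendsto (fun s : G => μ ((s • P \ s₀ • P) ∩ V)) (𝓝 s₀) (𝓝 0) ∧
      Tendsto (fun s : G => μ ((s₀ • P \ s • P) ∩ V)) (𝓝 s₀) (𝓝 0) := by
  obtain ⟨Z, hZ, hZ1⟩ := exists_compact_mem_nhds (1 : G)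
  have hL : IsCompact (Z⁻¹ * V) := hZ.inv.mul hV
  set Q : Set G := s₀ • P ∩ (Z⁻¹ * V) with hQ
  have hQm : MeasurableSet Q := (hP.const_smul s₀).inter hL.measurableSet
  have hQμ : μ Q ≠ ∞ := measure_ne_top_of_subset inter_subset_right hL.measure_lt_top.ne
  have hz : Tendsto (fun s : G => s * s₀⁻¹) (𝓝 s₀) (𝓝 1) := by
    have : ContinuousAt (fun s : G => s * s₀⁻¹) s₀ := by fun_prop
    simpa [ContinuousAt] using this
  have hzi : Tendsto (fun s : G => (s * s₀⁻¹)⁻¹) (𝓝 s₀) (𝓝 1) := by simpa using hz.inv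
  have hlim := tendsto_measure_smul_sdiff (μ := μ) hQm hQμ
  have hsP : ∀ s t, t ∈ s • P → (s * s₀⁻¹)⁻¹ • t ∈ s₀ • P := by
    rintro s _ ⟨q, hq, rfl⟩
    exact ⟨q, hq, by simp⟩
  constructor
  · refine tendsto_of_tendsto_of_tendsto_of_le_of_le' tendsto_const_nhds (hlim.comp hz)
      (Eventually.of_forall fun _ => zero_le) ?_
    filter_upwards [hz.eventually_mem hZ1] with s hs
    refine measure_mono ?_
    rintro t ⟨⟨ht, ht'⟩, htV⟩
    refine ⟨mem_smul_set_iff_inv_smul_mem.2 ⟨hsP s t ht, ?_⟩, fun hc => ht' hc.1⟩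
    exact ⟨_, Set.inv_mem_inv.2 hs, t, htV, rfl⟩
  · refine tendsto_of_tendsto_of_tendsto_of_le_of_le' tendsto_const_nhds (hlim.comp hzi)
      (Eventually.of_forall fun _ => zero_le) ?_
    refine Eventually.of_forall fun s => ?_
    have h1 : (s₀ • P \ s • P) ∩ V ⊆ Q \ (s * s₀⁻¹) • Q := by
      rintro t ⟨⟨ht, ht'⟩, htV⟩
      refine ⟨⟨ht, ?_⟩, fun hc => ht' ?_⟩
      · exact ⟨1, by simpa using mem_of_mem_nhds hZ1, t, htV, one_mul t⟩
      · obtain ⟨q, ⟨⟨r, hr, rfl⟩, -⟩, rfl⟩ := hc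
        exact ⟨r, hr, by simp [mul_assoc]⟩
    refine (measure_mono h1).trans ?_
    rw [← measure_smul μ (s * s₀⁻¹)⁻¹ (Q \ _), smul_set_sdiff, inv_smul_smul]
    exact le_rfl

/-- The sets `N q ∩ V` form a countable base at 1. If `x` lies outside `U ⊇ W / W`, then `W` and `x
• W` are disjoint; but `s • P ≈ W` and `x * s` moves `P` to nearly `x • W`, so `x` cannot almost fix
`s • P`. -/
theorem firstCountableTopology_of_dense_translates [SigmaCompactSpace G] {P : Set G}
    (hP : MeasurableSet P)
    (hdense : ∀ A K : Set G, IsCompact A → IsCompact K → ∀ η : ℝ≥0∞, η ≠ 0 → η ≠ ∞ →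
      ∃ s : G, μ (K ∩ ((s • P \ A) ∪ (A \ s • P))) < η) :
    FirstCountableTopology G := by
  obtain ⟨V, hV, hV1⟩ := exists_compact_mem_nhds (1 : G)
  let N : ℕ × ℕ → Set G := fun q => {x | ∀ s ∈ compactCovering G q.1,
    μ ((s • P \ (x * s) • P) ∩ V) < ((q.2 : ℝ≥0∞))⁻¹}
  have hN : ∀ q, N q ∈ 𝓝 (1 : G) := by
    intro q
    -- Compactness makes the neighbourhood of 1 uniform in `s`, given the joint limit at `(1, s₀)`.
    refine (isCompact_compactCovering G q.1).eventually_forall_of_forall_eventually fun s₀ _ => ?_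
    obtain ⟨h1, h2⟩ := tendsto_measure_smul_sdiff_inter (μ := μ) hP hV s₀
    have hη : 0 < ((q.2 : ℝ≥0∞))⁻¹ / 2 := ENNReal.half_pos (by simp)
    have ha : Tendsto (fun z : G × G => z.1 * z.2) (𝓝 (1, s₀)) (𝓝 s₀) := by
      have : ContinuousAt (fun z : G × G => z.1 * z.2) (1, s₀) := by fun_prop
      simpa [ContinuousAt] using this
    have hb : Tendsto (fun z : G × G => z.2) (𝓝 (1, s₀)) (𝓝 s₀) := continuousAt_snd
    filter_upwards [(h2.comp ha).eventually (gt_mem_nhds hη),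
      (h1.comp hb).eventually (gt_mem_nhds hη)] with z hz1 hz2
    simp only [Function.comp_apply] at hz1 hz2
    calc _ ≤ μ (((z.2 • P \ s₀ • P) ∩ V) ∪ ((s₀ • P \ (z.1 * z.2) • P) ∩ V)) := by
          refine measure_mono ?_
          rintro t ⟨⟨ht, ht'⟩, htV⟩
          by_cases hts : t ∈ s₀ • P
          · exact Or.inr ⟨⟨hts, ht'⟩, htV⟩
          · exact Or.inl ⟨⟨ht, hts⟩, htV⟩
      _ ≤ _ := measure_union_le _ _
      _ < _ := ENNReal.add_lt_add hz2 hz1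
      _ = _ := ENNReal.add_halves _
  have key : ∀ U ∈ 𝓝 (1 : G), ∃ q, N q ∩ V ⊆ U := by
    intro U hU
    obtain ⟨U', hU', hUU⟩ := exists_nhds_split_inv hU
    obtain ⟨W, hW1, hWU, hW⟩ := local_compact_nhds (inter_mem hU' hV1)
    have hμW : μ W ≠ 0 := (Measure.measure_pos_of_mem_nhds μ hW1).ne'
    have hη : μ W / 3 ≠ 0 := (ENNReal.div_pos hμW (by simp)).ne'
    have hη' : μ W / 3 ≠ ∞ := (ENNReal.div_lt_top hW.measure_lt_top.ne (by simp)).ne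
    obtain ⟨n, hn⟩ := ENNReal.exists_inv_nat_lt hη
    -- `V⁻¹ * V` contains `V` and each `x⁻¹ • V` with `x ∈ V`, so the approximation can be used both
    -- on `W` and after translation by `x⁻¹`.
    obtain ⟨s, hs⟩ := hdense W (V⁻¹ * V) hW (hV.inv.mul hV) _ hη hη'
    obtain ⟨m, hm⟩ := mem_iUnion.1 ((iUnion_compactCovering G).symm ▸ mem_univ s :
      s ∈ ⋃ n, compactCovering G n)
    refine ⟨(m, n), ?_⟩
    rintro x ⟨hx, hxV⟩
    by_contra hxU
    have hdisj : ∀ t ∈ W, t ∉ x • W := by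
      rintro _ ht ⟨w, hw, rfl⟩
      refine hxU ?_
      have := hUU _ (hWU ht).1 _ (hWU hw).1
      simpa using this
    have h1V : (1 : G) ∈ V := mem_of_mem_nhds hV1
    have h1 : μ (W \ s • P) < μ W / 3 := by
      refine (measure_mono ?_).trans_lt hs
      rintro t ⟨ht, ht'⟩
      exact ⟨⟨1, by simpa using h1V, t, (hWU ht).2, one_mul t⟩, Or.inr ⟨ht, ht'⟩⟩
    have h2 : μ ((s • P \ (x * s) • P) ∩ V) < μ W / 3 := (hx s hm).trans hn
    have h3 : μ (((x * s) • P \ x • W) ∩ W) < μ W / 3 := by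
      rw [← measure_smul μ x⁻¹]
      refine (measure_mono ?_).trans_lt hs
      rintro _ ⟨t, ⟨⟨⟨r, hr, rfl⟩, ht⟩, htW⟩, rfl⟩
      refine ⟨⟨x⁻¹, Set.inv_mem_inv.2 hxV, _, (hWU htW).2, rfl⟩, Or.inl ⟨⟨r, hr, ?_⟩, ?_⟩⟩
      · simp [mul_assoc]
      · rwa [mem_smul_set_iff_inv_smul_mem] at ht
    refine lt_irrefl (μ W) ?_
    calc μ W ≤ μ ((W \ s • P) ∪ ((s • P \ (x * s) • P) ∩ V) ∪
          (((x * s) • P \ x • W) ∩ W)) := by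
          refine measure_mono fun t ht => ?_
          by_cases hc : t ∈ s • P
          · by_cases hc' : t ∈ (x * s) • P
            · exact Or.inr ⟨⟨hc', hdisj t ht⟩, ht⟩
            · exact Or.inl (Or.inr ⟨⟨hc, hc'⟩, (hWU ht).2⟩)
          · exact Or.inl (Or.inl ⟨ht, hc⟩)
      _ ≤ μ (W \ s • P) + μ ((s • P \ (x * s) • P) ∩ V) + μ (((x * s) • P \ x • W) ∩ W) :=
          (measure_union_le _ _).trans (by gcongr; exact measure_union_le _ _)
      _ < μ W / 3 + μ W / 3 + μ W / 3 := ENNReal.add_lt_add (ENNReal.add_lt_add h1 h2) h3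
      _ = μ W := ENNReal.add_thirds _
  have h1 : (𝓝 (1 : G)).IsCountablyGenerated := by
    refine ⟨range fun q => N q ∩ V, countable_range _, le_antisymm ?_ fun U hU => ?_⟩
    · rw [le_generate_iff]
      rintro _ ⟨q, rfl⟩
      exact inter_mem (hN q) hV1
    · obtain ⟨q, hq⟩ := key U hU
      exact mem_of_superset (mem_generate_of_mem ⟨q, rfl⟩) hq
  refine ⟨fun a => ?_⟩
  rw [← map_mul_left_nhds_one a]
  infer_instance

theorem HasDenseVectors.noncompactSpace_and_secondCountableTopology
    (h : HasDenseVectors μ p ω univ) (hp0 : p ≠ 0) (hp : p ≠ ∞) :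
    NoncompactSpace G ∧ SecondCountableTopology G := by
  obtain ⟨hw, -, f', hf'⟩ := h
  obtain ⟨f, hfm, hf⟩ := hf'.exists_measurable hw
  refine ⟨hf.noncompactSpace hw hp0 hp, ?_⟩
  have := hf.sigmaCompactSpace hw hp0 hp hfm
  have hP : MeasurableSet {t | ‖f t - 1‖ < 1 / 2} :=
    measurableSet_lt (hfm.sub_const 1).norm measurable_const
  have : FirstCountableTopology G := by
    refine firstCountableTopology_of_dense_translates (μ := μ) hP fun A K hA hK η hη hη' => ?_
    obtain ⟨s, hs⟩ := hf.exists_translate_close_in_measure hw hp0 hp hA hK (δ := 1 / 2)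
      (by norm_num) hη hη'
    refine ⟨s, (measure_mono ?_).trans_lt hs⟩
    rintro t ⟨htK, ht⟩
    refine ⟨htK, ?_⟩
    simp only [mem_union, Set.mem_sdiff, mem_smul_set_iff_inv_smul_mem, mem_ofPred_eq,
      smul_eq_mul] at ht ⊢
    rcases ht with ⟨h1, h2⟩ | ⟨h1, h2⟩
    · rw [indicator_of_notMem h2, sub_zero]
      have h3 := norm_sub_le (f (s⁻¹ * t)) (f (s⁻¹ * t) - 1)
      rw [sub_sub_cancel, norm_one] at h3
      linarith
    · rw [indicator_of_mem h1]
      exact not_lt.1 h2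
  let u : UniformSpace G := IsTopologicalGroup.rightUniformSpace G
  have : (uniformity G).IsCountablyGenerated :=
    comap.isCountablyGenerated (𝓝 (1 : G)) fun q : G × G => q.2 * q.1⁻¹
  let I : PseudoMetricSpace G := UniformSpace.pseudoMetricSpace G
  exact EMetric.secondCountable_of_sigmaCompact G

end SecondCountable

/-! ### Proper lengths and their weights. -/

/-- A symmetric, almost subadditive, measurable length function with relatively compact balls. -/
structure IsProperLength {G : Type*} [Group G] [TopologicalSpace G] [MeasurableSpace G]
    (ℓ : G → ℕ) : Prop where
  measurable : Measurable ℓ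
  map_inv : ∀ x, ℓ x⁻¹ = ℓ x
  map_mul_le : ∀ x y, ℓ (x * y) ≤ ℓ x + ℓ y + 1
  exists_isCompact : ∀ n, ∃ K, IsCompact K ∧ {x | ℓ x ≤ n} ⊆ K

theorem exists_isProperLength (G : Type*) [Group G] [TopologicalSpace G] [IsTopologicalGroup G]
    [T2Space G] [SigmaCompactSpace G] [MeasurableSpace G] [BorelSpace G] :
    ∃ ℓ : G → ℕ, IsProperLength ℓ := by
  classical
  obtain ⟨E, hE, hE1, hEinv, hEmul, hCE⟩ :=
    exists_isCompact_mul_exhaustion (compactCovering G) (isCompact_compactCovering G)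
  have hmono : Monotone E := monotone_nat_of_le_succ fun n x hx =>
    hEmul n ⟨x, hx, 1, hE1 n, mul_one x⟩
  have hex : ∀ x, ∃ n, x ∈ E n := fun x => by
    obtain ⟨n, hn⟩ := exists_mem_compactCovering x
    exact ⟨n, hCE n hn⟩
  have hle : ∀ x n, Nat.find (hex x) ≤ n ↔ x ∈ E n := fun x n =>
    ⟨fun h => hmono h (Nat.find_spec (hex x)), fun h => Nat.find_min' _ h⟩
  -- The extra `+ 1` in the length inequality is the index shift in `E n * E n ⊆ E (n + 1)`.
  refine ⟨fun x => Nat.find (hex x), measurable_of_Iic fun n => ?_, fun x => ?_, fun x y => ?_,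
    fun n => ⟨E n, hE n, fun x hx => (hle x n).1 hx⟩⟩
  · have : (fun x => Nat.find (hex x)) ⁻¹' Iic n = E n := by
      ext x
      exact hle x n
    rw [this]
    exact (hE n).measurableSet
  · refine eq_of_forall_ge_iff fun n => ?_
    rw [hle, hle, ← Set.mem_inv, hEinv]
  · refine (hle _ _).2 (hEmul _ ⟨x, hmono ?_ (Nat.find_spec (hex x)), y,
      hmono ?_ (Nat.find_spec (hex y)), rfl⟩) <;> simp

/-- The weight `2 ^ (-ℓ)`. -/
noncomputable def lengthWeight {G : Type*} (ℓ : G → ℕ) : G → ℝ := fun t => (2⁻¹ : ℝ) ^ ℓ t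

theorem lengthWeight_pos {G : Type*} (ℓ : G → ℕ) (t : G) : 0 < lengthWeight ℓ t := by
  unfold lengthWeight; positivity

theorem lengthWeight_le_of_le {G : Type*} {ℓ : G → ℕ} {x y : G} {n : ℕ} (h : ℓ y ≤ n + ℓ x) :
    lengthWeight ℓ x ≤ 2 ^ n * lengthWeight ℓ y := by
  unfold lengthWeight
  calc (2⁻¹ : ℝ) ^ ℓ x = 2 ^ n * 2⁻¹ ^ (n + ℓ x) := by
        rw [pow_add, ← mul_assoc, ← mul_pow]; norm_num
    _ ≤ 2 ^ n * 2⁻¹ ^ ℓ y := by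
        gcongr ?_ * ?_
        exact pow_le_pow_of_le_one (by norm_num) (by norm_num) h

theorem exists_seq_length_add_le {G : Type*} {ℓ : G → ℕ} {S : Set G} (hS : ∀ R, ∃ s ∈ S, R ≤ ℓ s) (B : ℕ → ℕ) :
    ∃ s : ℕ → G, (∀ n, s n ∈ S) ∧ (∀ n, B n ≤ ℓ (s n)) ∧
      ∀ m n, m < n → ℓ (s m) + B m + B n ≤ ℓ (s n) := by
  choose σ hσS hσ using hS
  -- `A n` accumulates `B m + ℓ (s m)` over all `m < n`, so asking for length at least `A n + B n`
  -- dominates every earlier term.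
  let A : ℕ → ℕ := fun n => Nat.rec 0 (fun n a => a + B n + ℓ (σ (a + B n))) n
  have hA : ∀ n, A (n + 1) = A n + B n + ℓ (σ (A n + B n)) := fun n => rfl
  have hmono : Monotone A := monotone_nat_of_le_succ fun n => by rw [hA]; omega
  refine ⟨fun n => σ (A n + B n), fun n => hσS _, fun n => ?_, fun m n hmn => ?_⟩
  · exact le_trans (Nat.le_add_left _ _) (hσ (A n + B n))
  · have h1 := hσ (A n + B n)
    have h2 := hmono (Nat.succ_le_of_lt hmn)
    rw [Nat.succ_eq_add_one, hA] at h2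
    simp only
    omega

/-! ### Norm estimates for series, tails and compositions. -/

section Norms

variable {G : Type*} [MeasurableSpace G] {μ : Measure G} {p : ℝ≥0∞}

theorem aestronglyMeasurable_of_tendsto_sum {u : ℕ → G → ℂ} {F : G → ℂ}
    (hu : ∀ m, AEStronglyMeasurable (u m) μ) (hF : ∀ t, HasSum (fun m => u m t) (F t)) :
    AEStronglyMeasurable F μ := by
  refine aestronglyMeasurable_of_tendsto_ae atTop
    (f := fun N => ∑ m ∈ Finset.range N, u m) (fun N => Finset.aestronglyMeasurable_sum _
      fun m _ => hu m) (Eventually.of_forall fun t => ?_)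
  simpa using (hF t).tendsto_sum_nat

theorem eLpNorm_le_tsum {u : ℕ → G → ℂ} {F : G → ℂ} (hp : 1 ≤ p)
    (hu : ∀ m, AEStronglyMeasurable (u m) μ) (hF : ∀ t, HasSum (fun m => u m t) (F t)) :
    eLpNorm F p μ ≤ ∑' m, eLpNorm (u m) p μ := by
  refine (Lp.eLpNorm_lim_le_liminf_eLpNorm (f := fun N => ∑ m ∈ Finset.range N, u m)
    (fun N => Finset.aestronglyMeasurable_sum _ fun m _ => hu m) F
    (Eventually.of_forall fun t => ?_)).trans ?_
  · simpa using (hF t).tendsto_sum_nat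
  · refine liminf_le_of_frequently_le' (Frequently.of_forall fun N => ?_)
    exact (eLpNorm_sum_le (fun m _ => hu m) hp).trans (ENNReal.sum_le_tsum _)

/-- The measure with density `|f| ^ p` is finite, hence continuous from above. -/
theorem MemLp.tendsto_eLpNorm_indicator {f : G → ℂ} (hp0 : p ≠ 0) (hp : p ≠ ∞)
    (hf : MemLp f p μ) {s : ℕ → Set G} (hs : ∀ n, MeasurableSet (s n)) (hanti : Antitone s)
    (hempty : ⋂ n, s n = ∅) :
    Tendsto (fun n => eLpNorm ((s n).indicator f) p μ) atTop (𝓝 0) := by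
  set ν := μ.withDensity fun t => ‖f t‖ₑ ^ p.toReal with hν
  have hfin : ν univ ≠ ∞ := by
    rw [hν, withDensity_apply _ MeasurableSet.univ, Measure.restrict_univ]
    exact (lintegral_rpow_enorm_lt_top_of_eLpNorm_lt_top hp0 hp hf.2).ne
  have h := tendsto_measure_iInter_atTop (μ := ν) (fun n => (hs n).nullMeasurableSet) hanti
    ⟨0, measure_ne_top_of_subset (subset_univ _) hfin⟩
  rw [hempty, measure_empty] at h
  have hp' : 0 < 1 / p.toReal := one_div_pos.2 (ENNReal.toReal_pos hp0 hp)
  have h2 := ((ENNReal.continuous_rpow_const (y := 1 / p.toReal)).tendsto 0).comp h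
  rw [ENNReal.zero_rpow_of_pos hp'] at h2
  refine h2.congr fun n => ?_
  rw [eLpNorm_indicator_eq_eLpNorm_restrict (hs n),
    eLpNorm_eq_lintegral_rpow_enorm_toReal hp0 hp]
  simp only [Function.comp_apply, hν, withDensity_apply _ (hs n)]

theorem boundedOn_comp {ω : G → ℝ} (hω : Measurable ω) (hpos : ∀ t, 0 < ω t) (hp : p ≠ ∞)
    {φ : G → G} (hφ : Measurable φ) {c : ℝ≥0} (hc : μ.map φ = c • μ) {C : ℝ}
    (hC : ∀ t, ω t ≤ C * ω (φ t)) : BoundedOn μ p ω fun f t => f (φ t) := by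
  let D : ℝ≥0∞ := (c : ℝ≥0∞) ^ (1 / p).toReal
  have hD : D ≠ ∞ := ENNReal.rpow_ne_top_of_nonneg ENNReal.toReal_nonneg ENNReal.coe_ne_top
  refine ⟨C.toNNReal * D.toNNReal, fun f hf => ?_⟩
  have hac : μ.map φ ≪ μ := by
    rw [hc]
    exact Measure.smul_absolutelyContinuous
  have hfm := hf.aestronglyMeasurable hω hpos
  have hle : weightedNorm μ p ω (fun t => f (φ t)) ≤
      (C.toNNReal * D.toNNReal : ℝ≥0) * weightedNorm μ p ω f := by
    have h1 : eLpNorm (fun t => f (φ t) * (ω t : ℂ)) p μ ≤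
        ENNReal.ofReal C * eLpNorm ((fun t => f t * (ω t : ℂ)) ∘ φ) p μ := by
      refine eLpNorm_le_mul_eLpNorm_of_ae_le_mul (Eventually.of_forall fun t => ?_) p
      simp only [Function.comp_apply, norm_mul, Complex.norm_real,
        Real.norm_of_nonneg (hpos _).le]
      calc ‖f (φ t)‖ * ω t ≤ ‖f (φ t)‖ * (C * ω (φ t)) := by gcongr; exact hC t
        _ = _ := by ring
    have h2 : eLpNorm ((fun t => f t * (ω t : ℂ)) ∘ φ) p μ =
        D * eLpNorm (fun t => f t * (ω t : ℂ)) p μ := by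
      rw [← eLpNorm_map_measure (hf.1.mono_ac hac) hφ.aemeasurable, hc]
      exact eLpNorm_smul_measure_of_ne_top hp _ (c : ℝ≥0∞)
    rw [h2] at h1
    rw [ENNReal.coe_mul, ENNReal.coe_toNNReal hD, mul_assoc]
    exact h1
  refine ⟨⟨?_, hle.trans_lt (ENNReal.mul_lt_top ENNReal.coe_lt_top hf.2)⟩, hle⟩
  exact ((hfm.mono_ac hac).comp_measurable hφ).mul
    (Complex.measurable_ofReal.comp hω).aestronglyMeasurable

end Norms

/-- On the translated support the weight is at most `2 ^ (-(r + c))`, and `2 ^ (-c)` cancels the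
unweighted norm of `g`. -/
theorem weightedNorm_leftTranslate_le {G : Type*} [Group G] [MeasurableSpace G] [MeasurableMul G]
    {ℓ : G → ℕ} {μ : Measure G} {p : ℝ≥0∞} [μ.IsMulLeftInvariant]
    {g : G → ℂ} {k c r : ℕ} {x : G} (hgm : AEStronglyMeasurable g μ)
    (hg : ∀ t, g t ≠ 0 → ℓ t ≤ k) (hgp : eLpNorm g p μ ≤ 2 ^ c)
    (hx : ∀ y, ℓ y ≤ k → r + c ≤ ℓ (x * y)) :
    weightedNorm μ p (lengthWeight ℓ) (leftTranslate x g) ≤ 2⁻¹ ^ r := by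
  have h1 : weightedNorm μ p (lengthWeight ℓ) (leftTranslate x g) ≤
      ENNReal.ofReal (2⁻¹ ^ (r + c)) * eLpNorm (g ∘ fun t => x⁻¹ * t) p μ := by
    refine eLpNorm_le_mul_eLpNorm_of_ae_le_mul (Eventually.of_forall fun t => ?_) p
    simp only [Function.comp_apply, leftTranslate, norm_mul, Complex.norm_real,
      Real.norm_of_nonneg (lengthWeight_pos ℓ _).le]
    by_cases h0 : g (x⁻¹ * t) = 0
    · simp [h0]
    · have := hx _ (hg _ h0)
      rw [mul_inv_cancel_left] at this
      rw [mul_comm]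
      gcongr
      exact pow_le_pow_of_le_one (by norm_num) (by norm_num) this
  rw [eLpNorm_comp_measurePreserving hgm (measurePreserving_mul_left μ x⁻¹)] at h1
  refine h1.trans ((mul_le_mul_right hgp _).trans_eq ?_)
  rw [ENNReal.ofReal_pow (by norm_num), ENNReal.ofReal_inv_of_pos (by norm_num),
    ENNReal.ofReal_ofNat, pow_add, mul_assoc, ← mul_pow,
    ENNReal.inv_mul_cancel (by norm_num) (by norm_num), one_pow, mul_one]

/-! ### Bounded translations and dense vectors for the weight of a proper length. -/

section Length

variable {G : Type*} [Group G] [TopologicalSpace G] [MeasurableSpace G] {ℓ : G → ℕ}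
  {μ : Measure G} {p : ℝ≥0∞}

theorem IsProperLength.measurable_lengthWeight (hℓ : IsProperLength ℓ) :
    Measurable (lengthWeight ℓ) :=
  (measurable_from_nat (f := fun n : ℕ => (2⁻¹ : ℝ) ^ n)).comp hℓ.measurable

theorem IsProperLength.isWeight [IsFiniteMeasureOnCompacts μ] (hℓ : IsProperLength ℓ) :
    IsWeight μ p (lengthWeight ℓ) where
  measurable := hℓ.measurable_lengthWeight
  pos := lengthWeight_pos ℓ
  locally_summable K hK := by
    have : IsFiniteMeasure (μ.restrict K) := ⟨by
      rw [Measure.restrict_apply_univ]; exact hK.measure_lt_top⟩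
    refine MemLp.of_bound hℓ.measurable_lengthWeight.aestronglyMeasurable 1
      (Eventually.of_forall fun t => ?_)
    rw [Real.norm_of_nonneg (lengthWeight_pos ℓ t).le]
    exact pow_le_one₀ (by norm_num) (by norm_num)

theorem IsProperLength.boundedOn_leftTranslate [MeasurableMul G] [μ.IsMulLeftInvariant]
    (hℓ : IsProperLength ℓ) (hp : p ≠ ∞) (s : G) :
    BoundedOn μ p (lengthWeight ℓ) (leftTranslate s) := by
  refine boundedOn_comp hℓ.measurable_lengthWeight (lengthWeight_pos ℓ) hp
    (φ := fun t => s⁻¹ * t) (measurable_const_mul _) (c := 1) (C := 2 ^ (ℓ s + 1)) ?_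
    fun t => lengthWeight_le_of_le ?_
  · rw [one_smul]
    exact (measurePreserving_mul_left μ s⁻¹).map_eq
  · have := hℓ.map_mul_le s⁻¹ t
    rw [hℓ.map_inv] at this
    omega

theorem IsProperLength.boundedOn_rightTranslate [IsTopologicalGroup G] [BorelSpace G]
    [LocallyCompactSpace G] [SecondCountableTopology G] [μ.IsHaarMeasure]
    (hℓ : IsProperLength ℓ) (hp : p ≠ ∞) (s : G) :
    BoundedOn μ p (lengthWeight ℓ) (rightTranslate s) := by
  -- The image of a Haar measure under right translation is again left invariant, hence a scalar
  -- multiple of it.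
  refine boundedOn_comp hℓ.measurable_lengthWeight (lengthWeight_pos ℓ) hp
    (φ := fun t => t * s) (measurable_mul_const _) (C := 2 ^ (ℓ s + 1))
    (Measure.isMulLeftInvariant_eq_smul _ μ) fun t => lengthWeight_le_of_le ?_
  have := hℓ.map_mul_le t s
  omega

theorem tsum_inv_two_pow_add (n : ℕ) : ∑' m : ℕ, (2⁻¹ : ℝ≥0∞) ^ (n + m) = 2⁻¹ ^ n * 2 := by
  simp_rw [pow_add, ENNReal.tsum_mul_left, ENNReal.tsum_geometric, ENNReal.one_sub_inv_two,
    inv_inv]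

theorem IsProperLength.exists_isDenseVector_of_seq [MeasurableMul G] [μ.IsMulLeftInvariant]
    (hℓ : IsProperLength ℓ) (hp : 1 ≤ p) {S : Set G} (hS : ∀ R, ∃ s ∈ S, R ≤ ℓ s)
    {g : ℕ → G → ℂ} {k c : ℕ → ℕ} (hgm : ∀ n, AEStronglyMeasurable (g n) μ)
    (hg : ∀ n t, g n t ≠ 0 → ℓ t ≤ k n) (hgp : ∀ n, eLpNorm (g n) p μ ≤ 2 ^ c n)
    (hdense : ∀ h, MemWeighted μ p (lengthWeight ℓ) h → ∀ ε : ℝ≥0∞, 0 < ε → ∀ N, ∃ n ≥ N,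
      weightedNorm μ p (lengthWeight ℓ) (g n - h) < ε) :
    ∃ f, IsDenseVector μ p (lengthWeight ℓ) S f := by
  -- In the gap, `k n` pays for the support of `g n`, `c n` for its norm, `n` gives geometric decay,
  -- and `2` absorbs the `+ 1` of two length inequalities.
  obtain ⟨s, hsS, hsB, hs⟩ := exists_seq_length_add_le hS fun n => n + k n + c n + 2
  have hωm : AEStronglyMeasurable (fun t => (lengthWeight ℓ t : ℂ)) μ :=
    (Complex.measurable_ofReal.comp hℓ.measurable_lengthWeight).aestronglyMeasurable
  have htrans : ∀ x m, AEStronglyMeasurable (leftTranslate x (g m)) μ := fun x m =>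
    (hgm m).comp_measurePreserving (measurePreserving_mul_left μ x⁻¹)
  have hfar : ∀ m y, ℓ y ≤ k m → m + c m ≤ ℓ ((s m)⁻¹ * y) := by
    intro m y hy
    have h1 := hℓ.map_mul_le y ((s m)⁻¹ * y)⁻¹
    rw [hℓ.map_inv, show y * ((s m)⁻¹ * y)⁻¹ = s m by group] at h1
    have := hsB m
    omega
  have hfar2 : ∀ n m, m ≠ n → ∀ y, ℓ y ≤ k m → n + m + c m ≤ ℓ (s n * (s m)⁻¹ * y) := by
    intro n m hmn y hy
    set z := s n * (s m)⁻¹ * y with hz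
    rcases lt_or_gt_of_ne hmn with h | h
    · have h1 := hs m n h
      have h2 := hℓ.map_mul_le z (y⁻¹ * s m)
      have h3 := hℓ.map_mul_le y⁻¹ (s m)
      rw [hℓ.map_inv] at h3
      rw [show z * (y⁻¹ * s m) = s n by rw [hz]; group] at h2
      omega
    · have h1 := hs n m h
      have h2 := hℓ.map_mul_le y (z⁻¹ * s n)
      have h3 := hℓ.map_mul_le z⁻¹ (s n)
      rw [hℓ.map_inv] at h3
      rw [show y * (z⁻¹ * s n) = s m by rw [hz]; group] at h2
      omega
  let f : G → ℂ := fun t => ∑' m, g m (s m * t)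
  have hf : ∀ t, HasSum (fun m => g m (s m * t)) (f t) := fun t => by
    -- The sum is locally finite: `g m (s m * t) ≠ 0` forces `m ≤ ℓ t`.
    refine (summable_of_ne_finset_zero (s := Finset.range (ℓ t + 1)) fun m hm => ?_).hasSum
    by_contra h0
    have h1 := hg m _ h0
    have h2 := hfar m _ h1
    rw [inv_mul_cancel_left] at h2
    rw [Finset.mem_range] at hm
    omega
  have hfω : ∀ t, HasSum (fun m => leftTranslate (s m)⁻¹ (g m) t * (lengthWeight ℓ t : ℂ))
      (f t * (lengthWeight ℓ t : ℂ)) := fun t => by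
    simpa [leftTranslate] using (hf t).mul_right (lengthWeight ℓ t : ℂ)
  have hfmem : MemWeighted μ p (lengthWeight ℓ) f := by
    refine ⟨aestronglyMeasurable_of_tendsto_sum (fun m => (htrans _ m).mul hωm) hfω, ?_⟩
    refine (eLpNorm_le_tsum hp (fun m => (htrans _ m).mul hωm) hfω).trans_lt ?_
    have h1 : ∀ m, weightedNorm μ p (lengthWeight ℓ) (leftTranslate (s m)⁻¹ (g m)) ≤
        2⁻¹ ^ (0 + m) := fun m => by
      rw [zero_add]
      exact weightedNorm_leftTranslate_le (hgm m) (hg m) (hgp m) (hfar m)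
    refine (ENNReal.tsum_le_tsum h1).trans_lt ?_
    rw [tsum_inv_two_pow_add]
    simp
  have hclose : ∀ n, weightedNorm μ p (lengthWeight ℓ) (leftTranslate (s n) f - g n) ≤
      2⁻¹ ^ n * 2 := by
    intro n
    let u : ℕ → G → ℂ := fun m => if m = n then 0 else leftTranslate (s n * (s m)⁻¹) (g m)
    have hum : ∀ m, AEStronglyMeasurable (u m) μ := fun m => by
      by_cases hmn : m = n
      · simp only [u, if_pos hmn]; exact aestronglyMeasurable_const
      · simp only [u, if_neg hmn]; exact htrans _ m
    have hu : ∀ t, HasSum (fun m => u m t * (lengthWeight ℓ t : ℂ))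
        ((leftTranslate (s n) f - g n) t * (lengthWeight ℓ t : ℂ)) := fun t => by
      refine HasSum.mul_right _ ?_
      have h1 := (hf ((s n)⁻¹ * t)).sub (hasSum_ite_eq n (g n t))
      have h2 : (fun m => u m t) =
          fun m => g m (s m * ((s n)⁻¹ * t)) - if m = n then g n t else 0 := by
        ext m
        by_cases hmn : m = n
        · subst hmn; simp [u]
        · simp [u, hmn, leftTranslate, mul_assoc]
      rw [h2]
      exact h1
    refine (eLpNorm_le_tsum hp (fun m => (hum m).mul hωm) hu).trans ?_
    rw [← tsum_inv_two_pow_add]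
    refine ENNReal.tsum_le_tsum fun m => ?_
    by_cases hmn : m = n
    · simp [u, hmn]
    · simp only [u, if_neg hmn]
      exact weightedNorm_leftTranslate_le (hgm m) (hg m) (hgp m) (hfar2 n m hmn)
  refine ⟨f, hfmem, fun h hh ε hε => ?_⟩
  have hlim : Tendsto (fun n : ℕ => (2⁻¹ : ℝ≥0∞) ^ n * 2) atTop (𝓝 0) := by
    have := ENNReal.Tendsto.mul_const (b := 2) (ENNReal.tendsto_pow_atTop_nhds_zero_of_lt_one
      (r := 2⁻¹) (by simp)) (Or.inr (by simp))
    simpa using this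
  obtain ⟨N, hN⟩ := eventually_atTop.1
    (hlim.eventually (gt_mem_nhds (ENNReal.half_pos hε.ne')))
  obtain ⟨n, hnN, hn⟩ := hdense h hh (ε / 2) (ENNReal.half_pos hε.ne') N
  refine ⟨s n, hsS n, ?_⟩
  have hfm := hfmem.aestronglyMeasurable hℓ.measurable_lengthWeight (lengthWeight_pos ℓ)
  have hhm := hh.aestronglyMeasurable hℓ.measurable_lengthWeight (lengthWeight_pos ℓ)
  have hfm' : AEStronglyMeasurable (leftTranslate (s n) f) μ :=
    hfm.comp_measurePreserving (measurePreserving_mul_left μ (s n)⁻¹)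
  have hsplit : (fun t => (leftTranslate (s n) f - h) t * (lengthWeight ℓ t : ℂ)) =
      (fun t => (leftTranslate (s n) f - g n) t * (lengthWeight ℓ t : ℂ)) +
        fun t => (g n - h) t * (lengthWeight ℓ t : ℂ) := by
    ext t
    simp only [Pi.sub_apply, Pi.add_apply]
    ring
  unfold weightedNorm at hclose hn ⊢
  rw [hsplit]
  refine (eLpNorm_add_le ((hfm'.sub (hgm n)).mul hωm) (((hgm n).sub hhm).mul hωm) hp).trans_lt ?_
  calc _ < ε / 2 + ε / 2 := ENNReal.add_lt_add ((hclose n).trans_lt (hN n hnN)) hn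
    _ = ε := ENNReal.add_halves ε

/-- The approximants are a dense sequence of the unweighted `Lp`, divided by the weight and cut off
to balls, where `1 / ω ≤ 2 ^ k` keeps them in `Lp`. -/
theorem IsProperLength.exists_isDenseVector [MeasurableMul G] [μ.IsMulLeftInvariant]
    [MeasurableSpace.CountablyGenerated G] [SFinite μ]
    (hℓ : IsProperLength ℓ) (hp : 1 ≤ p) (hp' : p ≠ ∞) {S : Set G}
    (hS : ∀ R, ∃ s ∈ S, R ≤ ℓ s) :
    ∃ f, IsDenseVector μ p (lengthWeight ℓ) S f := by
  have : Fact (1 ≤ p) := ⟨hp⟩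
  have : Fact (p ≠ ∞) := ⟨hp'⟩
  have hp0 : p ≠ 0 := (zero_lt_one.trans_le hp).ne'
  let d : ℕ → Lp ℂ p μ := TopologicalSpace.denseSeq (Lp ℂ p μ)
  have hball : ∀ k, MeasurableSet {t | ℓ t ≤ k} := fun k =>
    measurableSet_le hℓ.measurable measurable_const
  let g : ℕ → ℕ → G → ℂ := fun i k =>
    {t | ℓ t ≤ k}.indicator fun t => d i t * ((lengthWeight ℓ t : ℂ))⁻¹
  have hgm : ∀ i k, AEStronglyMeasurable (g i k) μ := fun i k =>
    (((Lp.memLp (d i)).1).mul (Complex.measurable_ofReal.comp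
      hℓ.measurable_lengthWeight).inv.aestronglyMeasurable).indicator (hball k)
  have hgp : ∀ i k, eLpNorm (g i k) p μ < ∞ := fun i k => by
    refine (eLpNorm_le_mul_eLpNorm_of_ae_le_mul (c := 2 ^ k) (g := d i)
      (Eventually.of_forall fun t => ?_) p).trans_lt
      (ENNReal.mul_lt_top ENNReal.ofReal_lt_top (Lp.memLp (d i)).2)
    by_cases ht : ℓ t ≤ k
    · simp only [g]
      rw [indicator_of_mem (by exact ht), norm_mul, norm_inv, Complex.norm_real,
        Real.norm_of_nonneg (lengthWeight_pos ℓ t).le, mul_comm]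
      gcongr
      unfold lengthWeight
      rw [inv_pow, inv_inv]
      exact pow_le_pow_right₀ (by norm_num) ht
    · simp only [g]
      rw [indicator_of_notMem (by exact ht), norm_zero]
      positivity
  have hc : ∀ i k, ∃ c : ℕ, eLpNorm (g i k) p μ ≤ 2 ^ c := fun i k => by
    obtain ⟨n, hn⟩ := ENNReal.exists_nat_gt (hgp i k).ne
    refine ⟨n, hn.le.trans ?_⟩
    exact_mod_cast (Nat.lt_two_pow_self (n := n)).le
  choose c hc using hc
  refine hℓ.exists_isDenseVector_of_seq hp hS
    (g := fun n => g n.unpair.1.unpair.1 n.unpair.1.unpair.2)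
    (k := fun n => n.unpair.1.unpair.2) (c := fun n => c n.unpair.1.unpair.1 n.unpair.1.unpair.2)
    (fun n => hgm _ _) (fun n t ht => ?_) (fun n => hc _ _) fun h hh ε hε N => ?_
  · by_contra hlt
    exact ht (indicator_of_notMem (by exact hlt) _)
  have hε2 : 0 < ε / 2 := ENNReal.half_pos hε.ne'
  obtain ⟨_, ⟨i, rfl⟩, hi⟩ := EMetric.mem_closure_iff.1
    (TopologicalSpace.denseRange_denseSeq (Lp ℂ p μ) (MemLp.toLp _ hh)) (ε / 2) hε2
  rw [edist_comm, Lp.edist_def] at hi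
  have hi' : eLpNorm (fun t => d i t - h t * (lengthWeight ℓ t : ℂ)) p μ < ε / 2 := by
    refine lt_of_eq_of_lt (eLpNorm_congr_ae ?_) hi
    filter_upwards [hh.coeFn_toLp] with t ht
    simp [d, ht]
  have hlim := MemLp.tendsto_eLpNorm_indicator hp0 hp' (Lp.memLp (d i))
    (s := fun k => {t | ℓ t ≤ k}ᶜ) (fun k => (hball k).compl)
    (fun a b hab t ht hta => ht (le_trans (by exact hta) hab))
    (eq_empty_of_forall_notMem fun t ht => mem_iInter.1 ht (ℓ t) (by exact le_refl (ℓ t)))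
  obtain ⟨k, hk⟩ := (hlim.eventually (gt_mem_nhds hε2)).exists
  -- The last coordinate only pads the index: each approximant recurs at arbitrarily large `n`,
  -- where the error `2 ^ (1 - n)` is small.
  refine ⟨Nat.pair (Nat.pair i k) N, Nat.right_le_pair _ _, ?_⟩
  simp only [Nat.unpair_pair]
  have hsplit : (fun t => (g i k - h) t * (lengthWeight ℓ t : ℂ)) =
      (fun t => d i t - h t * (lengthWeight ℓ t : ℂ)) + -({t | ℓ t ≤ k}ᶜ.indicator (d i)) := by
    ext t
    have h0 : (lengthWeight ℓ t : ℂ) ≠ 0 := by exact_mod_cast (lengthWeight_pos ℓ t).ne'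
    by_cases ht : ℓ t ≤ k
    · simp only [g, Pi.sub_apply, Pi.add_apply, Pi.neg_apply]
      rw [indicator_of_mem (by exact ht), indicator_of_notMem (by simpa using ht)]
      field_simp
      simp
    · simp only [g, Pi.sub_apply, Pi.add_apply, Pi.neg_apply]
      rw [indicator_of_notMem (by exact ht), indicator_of_mem (by exact ht)]
      ring
  unfold weightedNorm
  rw [hsplit]
  refine (eLpNorm_add_le ((Lp.memLp (d i)).1.sub hh.1)
    ((Lp.memLp (d i)).1.indicator (hball k).compl).neg hp).trans_lt ?_
  rw [eLpNorm_neg]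
  calc _ < ε / 2 + ε / 2 := ENNReal.add_lt_add hi' hk
    _ = ε := ENNReal.add_halves ε

theorem IsProperLength.exists_mem_le_length [T2Space G] (hℓ : IsProperLength ℓ) {S : Set G}
    (hS : ¬ IsCompact (closure S)) (R : ℕ) : ∃ s ∈ S, R ≤ ℓ s := by
  by_contra! hcon
  obtain ⟨K, hK, hKR⟩ := hℓ.exists_isCompact R
  exact hS (hK.closure_of_subset (fun s hs => hKR (hcon s hs).le))

end Length

end WeightedTranslates

/-! ### The equivalence. -/

theorem mainTheorem2 {G : Type*} [Group G] [TopologicalSpace G] [IsTopologicalGroup G]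
    [LocallyCompactSpace G] [T2Space G] [MeasurableSpace G] [BorelSpace G]
    (μ : Measure G) [μ.IsHaarMeasure] [μ.Regular] :
    List.TFAE [
      -- (1)
      NoncompactSpace G ∧ SecondCountableTopology G,
      -- (2), one weight for all `p`
      NoncompactSpace G ∧ ∀ S : Set G, ¬ IsCompact (closure S) →
        ∃ ω : G → ℝ, ∀ p : ℝ≥0∞, 1 ≤ p → p ≠ ∞ → WeightedTranslates.HasDenseVectors μ p ω S,
      -- (2), some weight and some `p`
      NoncompactSpace G ∧ ∀ S : Set G, ¬ IsCompact (closure S) →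
        ∃ ω : G → ℝ, ∃ p : ℝ≥0∞, 1 ≤ p ∧ p ≠ ∞ ∧ WeightedTranslates.HasDenseVectors μ p ω S,
      -- (3), one weight for all `p`
      ∃ ω : G → ℝ, ∀ p : ℝ≥0∞, 1 ≤ p → p ≠ ∞ →
        WeightedTranslates.HasDenseVectorsTwoSided μ p ω,
      -- (3), some weight and some `p`
      ∃ ω : G → ℝ, ∃ p : ℝ≥0∞, 1 ≤ p ∧ p ≠ ∞ ∧
        WeightedTranslates.HasDenseVectorsTwoSided μ p ω] := by
  have huniv : NoncompactSpace G → ¬ IsCompact (closure (Set.univ : Set G)) := fun h => by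
    rw [closure_univ]
    exact noncompact_univ G
  have hp0 : ∀ p : ℝ≥0∞, 1 ≤ p → p ≠ 0 := fun p hp => (zero_lt_one.trans_le hp).ne'
  tfae_have 1 → 2 := by
    rintro ⟨hG, hG2⟩
    obtain ⟨ℓ, hℓ⟩ := WeightedTranslates.exists_isProperLength G
    exact ⟨hG, fun S hS => ⟨WeightedTranslates.lengthWeight ℓ, fun p hp hp' =>
      ⟨hℓ.isWeight, fun s _ => hℓ.boundedOn_leftTranslate hp' s,
        hℓ.exists_isDenseVector hp hp' (hℓ.exists_mem_le_length hS)⟩⟩⟩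
  tfae_have 1 → 4 := by
    rintro ⟨hG, hG2⟩
    obtain ⟨ℓ, hℓ⟩ := WeightedTranslates.exists_isProperLength G
    exact ⟨WeightedTranslates.lengthWeight ℓ, fun p hp hp' =>
      ⟨hℓ.isWeight, hℓ.boundedOn_leftTranslate hp', hℓ.boundedOn_rightTranslate hp',
        hℓ.exists_isDenseVector hp hp' (hℓ.exists_mem_le_length (huniv hG))⟩⟩
  tfae_have 2 → 3 := fun h => ⟨h.1, fun S hS =>
    let ⟨ω, hω⟩ := h.2 S hS
    ⟨ω, 1, le_rfl, ENNReal.one_ne_top, hω 1 le_rfl ENNReal.one_ne_top⟩⟩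
  tfae_have 4 → 5 := fun ⟨ω, hω⟩ =>
    ⟨ω, 1, le_rfl, ENNReal.one_ne_top, hω 1 le_rfl ENNReal.one_ne_top⟩
  tfae_have 3 → 1 := by
    rintro ⟨hG, h⟩
    obtain ⟨ω, p, hp, hp', hω⟩ := h Set.univ (huniv hG)
    exact hω.noncompactSpace_and_secondCountableTopology (hp0 p hp) hp'
  tfae_have 5 → 1 := by
    rintro ⟨ω, p, hp, hp', hw, hl, -, hf⟩
    have hω : WeightedTranslates.HasDenseVectors μ p ω Set.univ := ⟨hw, fun s _ => hl s, hf⟩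
    exact hω.noncompactSpace_and_secondCountableTopology (hp0 p hp) hp'
  tfae_finish
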